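/- Let $T$ be a locally finite tree (a connected acyclic graph in which every vertex has finitely many neighbours; $T$ also denotes its set of vertices) with graph distance $d$. Let $\Omega$ be its boundary, i.e. the set of equivalence classes of infinite geodesic rays, two rays being equivalent if they eventually coincide up to a shift. Fix $\omega_*\in\Omega$ and put $\partial T=\Omega\setminus\{\omega_*\}$. For $x,y\in T$ write $y\le x$ if $x$ lies on the geodesic ray from $y$ to $\omega_*$, and for $\omega\in\partial T$ write $\omega\le x$ if $x$ lies on the doubly infinite geodesic with endpoints $\omega$ and $\omega_*$. Set $T_x=\{y\in T: y\le x\}$ and $\partial T_x=\{\omega\in\partial T:\omega\le x\}$. Fix an origin $o\in T$, let $o=x_0,x_1,x_2,\dots$ be the successive vertices of the geodesic ray from $o$ to $\omega_*$, and define the level of $x\in T$ by $\ell(x)=\lim_{j\to\infty}(j-d(x,x_j))\in\mathbb Z$. Equip $\partial T$ with the topology generated by the sets $\partial T_x$, $x\in T$, and let $\nu$ be a Borel measure on $\partial T$ with $0<\nu(\partial T_x)<\infty$ for every $x\in T$. Put $m_\nu(x)=\nu(\partial T_x)$. For $f\in L^p(\partial T,\nu)$, $1\le p\le\infty$, real-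 or complex-valued, the Poisson integral of $f$ is $$\mathcal P f(x)=\int_{\partial T}\frac{\chi_{\partial T_x}(\omega)}{m_\nu(x)}\,f(\omega)\,\mathrm d\nu(\omega)=\frac1{m_\nu(x)}\int_{\partial T_x}f\,\mathrm d\nu ,\qquad x\in T.$$ For a function $u$ on $T$ put $\|u\|_{H^p}=\Big(\sup_{k\in\mathbb Z}\sum_{\ell(x)=k}|u(x)|^p\,m_\nu(x)\Big)^{1/p}$ if $1\le p<\infty$, and $\|u\|_{H^\infty}=\sup_{x\in T}|u(x)|$. Let $\sigma$ be a positive measure on $T$ (with all subsets of $T$ measurable), and put $\|u\|_{L^{1,\infty}(T,\sigma)}=\sup_{t>0}t\,\sigma(\{x\in T:|u(x)|>t\})$. Then the following are equivalent: (i) $\sigma$ is a Carleson measure: there is a constant $C>0$ such that $\sigma(T_x)\le C\,\nu(\partial T_x)$ for every $x\in T$; (ii) for every $p\in(1,\infty]$ there is a constant $C=C_p>0$ such that $\|\mathcal P f\|_{L^p(T,\sigma)}\le C\,\|f\|_{L^p(\partial T,\nu)}$ for every $f\in L^p(\partial T,\nu)$, and there is a constant $C>0$ such that $\|\mathcal P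 f\|_{L^{1,\infty}(T,\sigma)}\le C\,\|f\|_{L^1(\partial T,\nu)}$ for every $f\in L^1(\partial T,\nu)$; (iii) for every $p\in(1,\infty]$ there is a constant $C=C_p>0$ such that $\|\mathcal P f\|_{L^p(T,\sigma)}\le C\,\|\mathcal P f\|_{H^p}$ for every $f\in L^p(\partial T,\nu)$. -/

import Mathlib

open MeasureTheory Filter Topology
open scoped ENNReal NNReal

namespace TreeCarleson

variable {V : Type*}

/-- A ray of a graph: an infinite path, given by its successive (pairwise distinct) vertices.
In a tree these are exactly the infinite geodesics. -/
structure Ray (G : SimpleGraph V) where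
  /-- the `n`-th vertex of the ray -/
  toFun : ℕ → V
  adj : ∀ n, G.Adj (toFun n) (toFun (n + 1))
  inj : Function.Injective toFun

/-- Two rays are equivalent when they agree from some place on, up to a shift. -/
instance raySetoid (G : SimpleGraph V) : Setoid (Ray G) where
  r r s := ∃ m n : ℕ, ∀ k : ℕ, r.toFun (m + k) = s.toFun (n + k)
  iseqv :=
    { refl := fun _ => ⟨0, 0, fun _ => rfl⟩
      symm := fun ⟨m, n, h⟩ => ⟨n, m, fun k => (h k).symm⟩
      trans := by
        rintro r s t ⟨m, n, h⟩ ⟨m', n', h'⟩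
        refine ⟨m + m', n' + n, fun k => ?_⟩
        rw [add_assoc, h (m' + k), show n + (m' + k) = m' + (n + k) by omega, h' (n + k),
          add_assoc] }

/-- The boundary `Ω` of a tree: equivalence classes of rays. -/
def Boundary (G : SimpleGraph V) : Type _ := Quotient (raySetoid G)

/-- The boundary point in which a ray ends. -/
def Ray.endpoint {G : SimpleGraph V} (r : Ray G) : Boundary G := Quotient.mk (raySetoid G) r

/-- A doubly infinite geodesic of a tree. -/
structure Line (G : SimpleGraph V) where
  /-- the `n`-th vertex of the line -/
  toFun : ℤ → V
  adj : ∀ n, G.Adj (toFun n) (toFun (n + 1))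
  inj : Function.Injective toFun

/-- The half of a line with nonnegative indices. -/
def Line.forward {G : SimpleGraph V} (g : Line G) : Ray G where
  toFun n := g.toFun n
  adj n := by simpa using g.adj n
  inj _ _ h := by simpa using g.inj h

/-- The half of a line with nonpositive indices, run backwards. -/
def Line.backward {G : SimpleGraph V} (g : Line G) : Ray G where
  toFun n := g.toFun (-n)
  adj n := by
    have h := (g.adj (-(n : ℤ) - 1)).symm
    simpa [sub_eq_add_neg, add_comm] using h
  inj _ _ h := by simpa using g.inj h

/-- The punctured boundary `∂T = Ω ∖ {ω_*}`, where `root = ω_*`. -/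
def PuncturedBoundary (G : SimpleGraph V) (root : Boundary G) : Type _ :=
  {ω : Boundary G // ω ≠ root}

/-- `[x, ω)`: the vertices of the geodesic that starts at `x` and ends in `ω`. -/
def halfGeodesic {G : SimpleGraph V} (x : V) (ω : Boundary G) : Set V :=
  {y | ∃ r : Ray G, r.toFun 0 = x ∧ r.endpoint = ω ∧ y ∈ Set.range r.toFun}

/-- `(ω, ω')`: the vertices of the doubly infinite geodesic with endpoints `ω` and `ω'`. -/
def fullGeodesic {G : SimpleGraph V} (ω ω' : Boundary G) : Set V :=
  {y | ∃ g : Line G, g.backward.endpoint = ω ∧ g.forward.endpoint = ω' ∧ y ∈ Set.range g.toFun}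

/-- The sector `T_x`: the vertices `y` below `x`, that is, with `x ∈ [y, ω_*)`. -/
def sector {G : SimpleGraph V} (root : Boundary G) (x : V) : Set V :=
  {y | x ∈ halfGeodesic y root}

/-- The boundary at infinity `∂T_x` of a sector: the `ω ∈ ∂T` below `x`, that is, with
`x ∈ (ω, ω_*)`. -/
def sectorBoundary {G : SimpleGraph V} (root : Boundary G) (x : V) :
    Set (PuncturedBoundary G root) :=
  {ω | x ∈ fullGeodesic ω.1 root}

/-- The topology of `∂T`. The sets `∂T_x` are the balls of the Gromov distance of `∂T`. -/
instance {G : SimpleGraph V} {root : Boundary G} : TopologicalSpace (PuncturedBoundary G root) :=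
  TopologicalSpace.generateFrom (Set.range (sectorBoundary root))

instance {G : SimpleGraph V} {root : Boundary G} : MeasurableSpace (PuncturedBoundary G root) :=
  borel _

instance {G : SimpleGraph V} {root : Boundary G} : BorelSpace (PuncturedBoundary G root) := ⟨rfl⟩

/-- The level `ℓ(x) = lim_j (j - d(x, x_j))`, where `x_0, x_1, …` enumerates the geodesic `γ` from
the origin `o = x_0` to `ω_*`. In a tree the sequence is eventually constant. -/
noncomputable def level {G : SimpleGraph V} (γ : Ray G) (x : V) : ℤ :=
  haveI : Nonempty ℤ := ⟨0⟩
  limUnder atTop (fun j : ℕ => (j : ℤ) - (G.dist x (γ.toFun j) : ℤ))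

variable {G : SimpleGraph V} {root : Boundary G}

/-- The flow measure `m_ν(x) = ν(∂T_x)`. -/
noncomputable def flow (ν : Measure (PuncturedBoundary G root)) (x : V) : ℝ≥0∞ :=
  ν (sectorBoundary root x)

/-- The Poisson kernel `P(x, ω) = χ_{∂T_x}(ω) / m_ν(x)`. -/
noncomputable def poissonKernel (ν : Measure (PuncturedBoundary G root)) (x : V)
    (ω : PuncturedBoundary G root) : ℝ :=
  (sectorBoundary root x).indicator (fun _ => (1 : ℝ)) ω / (flow ν x).toReal

/-- The Poisson integral `𝒫 f(x) = ∫ P(x, ω) f(ω) dν(ω)`. -/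
noncomputable def poisson {𝕜 : Type*} [RCLike 𝕜] (ν : Measure (PuncturedBoundary G root))
    (f : PuncturedBoundary G root → 𝕜) (x : V) : 𝕜 :=
  ∫ ω, poissonKernel ν x ω • f ω ∂ν

/-- The `H^p`-norm, `1 ≤ p ≤ ∞`, of a function on the tree:
`(sup_k ∑_{ℓ(x) = k} |u(x)|^p m_ν(x))^{1/p}` if `p < ∞`, and `sup_x |u(x)|` if `p = ∞`. -/
noncomputable def hardyNorm {𝕜 : Type*} [RCLike 𝕜] (γ : Ray G)
    (ν : Measure (PuncturedBoundary G root)) (p : ℝ≥0∞) (u : V → 𝕜) : ℝ≥0∞ :=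
  if p = ∞ then ⨆ x, ‖u x‖ₑ
  else (⨆ k : ℤ, ∑' x : {x : V // level γ x = k}, ‖u x‖ₑ ^ p.toReal * flow ν x) ^ (1 / p.toReal)

/-- The weak quasi-norm `‖u‖_{L^{1,∞}(σ)} = sup_{t > 0} t σ{|u| > t}`. -/
noncomputable def weakL1Norm {𝕜 : Type*} [RCLike 𝕜] [MeasurableSpace V] (σ : Measure V)
    (u : V → 𝕜) : ℝ≥0∞ :=
  ⨆ (t : ℝ≥0) (_ : 0 < t), (t : ℝ≥0∞) * σ {x | (t : ℝ) < ‖u x‖}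

/-- `σ` is a Carleson measure: `σ(T_x) ≤ C ν(∂T_x)` for all vertices `x`. -/
def IsCarleson [MeasurableSpace V] (ν : Measure (PuncturedBoundary G root))
    (σ : Measure V) : Prop :=
  ∃ C : ℝ≥0, 0 < C ∧ ∀ x : V, σ (sector root x) ≤ C * ν (sectorBoundary root x)

end TreeCarleson

/-!
Testing `(iii)` on the indicator of `∂T_x`, whose Poisson integral is `1` on `T_x`, gives the
Carleson condition, since `𝒫` is a contraction from `L^p(ν)` to `H^p` by Jensen's inequality.
Conversely, the sets `∂T_x` over which the average of `|f|` exceeds `t` are covered by the maximal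
ones among them, which are pairwise disjoint; so the Carleson condition yields the weak type
`(1, 1)` bound as well as `t σ{|𝒫 f| > t} ≤ C ∫_{|2 f| > t} |2 f| dν`, and the latter integrates
to the strong bounds as in the proof of Doob's inequality. The `L^p(ν)` norm can finally be
replaced by the `H^p` norm because the restriction of `𝒫 f` to a level, seen as a function on
`∂T`, has norm at most `‖𝒫 f‖_{H^p}` and the same Poisson integral as `f` above that level. A
finite measure of `∂T_x` leaves room for only countably many vertices below `x` on each level, so
the tree is countable.
-/

namespace TreeCarleson

section Analysis

variable {α β E F : Type*} [MeasurableSpace α] [MeasurableSpace β]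
  [NormedAddCommGroup E] [NormedAddCommGroup F] {μ : Measure α} {ν : Measure β}

theorem enorm_average_mul_rpow_measure_univ_le_eLpNorm [NormedSpace ℝ E] {p : ℝ≥0∞} (hp : 1 ≤ p)
    {f : α → E} (hf : AEStronglyMeasurable f μ) :
    ‖⨍ x, f x ∂μ‖ₑ * μ Set.univ ^ (1 / p).toReal ≤ eLpNorm f p μ := by
  rcases eq_or_ne μ 0 with rfl | hμ
  · simp
  by_cases hfin : μ Set.univ = ∞
  · simp [average, hfin]
  have : IsFiniteMeasure μ := ⟨lt_top_iff_ne_top.2 hfin⟩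
  have : NeZero μ := ⟨hμ⟩
  have hunit : μ Set.univ ≠ 0 := by simpa using hμ
  calc ‖⨍ x, f x ∂μ‖ₑ * μ Set.univ ^ (1 / p).toReal
      ≤ eLpNorm f p ((μ Set.univ)⁻¹ • μ) * μ Set.univ ^ (1 / p).toReal := by
        gcongr
        refine (enorm_integral_le_lintegral_enorm _).trans ?_
        rw [← eLpNorm_one_eq_lintegral_enorm]
        exact eLpNorm_le_eLpNorm_of_exponent_le hp (hf.smul_measure _)
    _ = eLpNorm f p μ := by
        rw [eLpNorm_smul_measure_of_ne_zero (ENNReal.inv_ne_zero.2 hfin), smul_eq_mul,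
          mul_right_comm, ← ENNReal.mul_rpow_of_nonneg _ _ ENNReal.toReal_nonneg,
          ENNReal.inv_mul_cancel hunit hfin, ENNReal.one_rpow, one_mul]

theorem lintegral_enorm_rpow_eq_lintegral_measure_lt_norm_mul {f : α → E}
    (hf : AEStronglyMeasurable f μ) {p : ℝ} (hp : 0 < p) :
    ∫⁻ x, ‖f x‖ₑ ^ p ∂μ = ENNReal.ofReal p *
      ∫⁻ t in Set.Ioi (0 : ℝ), μ {x | t < ‖f x‖} * ENNReal.ofReal (t ^ (p - 1)) := by
  simp only [← lintegral_rpow_eq_lintegral_meas_lt_mul μ (.of_forall fun x => norm_nonneg (f x))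
    hf.norm.aemeasurable hp, ← ofReal_norm, ENNReal.ofReal_rpow_of_nonneg (norm_nonneg _) hp.le]

/-- Doob's argument: integrate the hypothesis against `p t ^ (p - 2) dt` and read both sides off
the layer cake formula, the right one for the measure `‖f‖ dν` and the exponent `p - 1`. -/
theorem lintegral_enorm_rpow_le_of_mul_measure_lt_norm_le {u : α → E} {f : β → F}
    (hu : AEStronglyMeasurable u μ) (hf : AEStronglyMeasurable f ν) {C : ℝ≥0}
    (h : ∀ t : ℝ, 0 < t → ENNReal.ofReal t * μ {x | t < ‖u x‖} ≤
      C * ∫⁻ y in {y | t < ‖f y‖}, ‖f y‖ₑ ∂ν) {p : ℝ} (hp : 1 < p) :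
    ∫⁻ x, ‖u x‖ₑ ^ p ∂μ ≤ C * ENNReal.ofReal (p / (p - 1)) * ∫⁻ y, ‖f y‖ₑ ^ p ∂ν := by
  set ν' := ν.withDensity fun y => ‖f y‖ₑ
  have hν' : ν' ≪ ν := withDensity_absolutelyContinuous _ _
  have hp1 : 0 < p - 1 := sub_pos.2 hp
  have hweak : ∀ t ∈ Set.Ioi (0 : ℝ), μ {x | t < ‖u x‖} * ENNReal.ofReal (t ^ (p - 1)) ≤
      C * (ν' {y | t < ‖f y‖} * ENNReal.ofReal (t ^ (p - 1 - 1))) := fun t (ht : 0 < t) =>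
    calc μ {x | t < ‖u x‖} * ENNReal.ofReal (t ^ (p - 1))
        = ENNReal.ofReal t * μ {x | t < ‖u x‖} * ENNReal.ofReal (t ^ (p - 1 - 1)) := by
          rw [mul_comm (ENNReal.ofReal t), mul_assoc, ← ENNReal.ofReal_mul ht.le,
            Real.rpow_sub_one ht.ne' (p - 1), mul_div_cancel₀ _ ht.ne']
      _ ≤ C * ν' {y | t < ‖f y‖} * ENNReal.ofReal (t ^ (p - 1 - 1)) := by
          gcongr ?_ * _
          exact (h t ht).trans (mul_le_mul_right (withDensity_apply_le _ _) _)
      _ = _ := mul_assoc _ _ _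
  have hdensity : ∫⁻ y, ‖f y‖ₑ ^ (p - 1) ∂ν' = ∫⁻ y, ‖f y‖ₑ ^ p ∂ν := by
    rw [lintegral_withDensity_eq_lintegral_mul₀ hf.enorm (hf.enorm.pow_const _)]
    refine lintegral_congr fun y => ?_
    calc ‖f y‖ₑ * ‖f y‖ₑ ^ (p - 1) = ‖f y‖ₑ ^ (1 : ℝ) * ‖f y‖ₑ ^ (p - 1) := by
          rw [ENNReal.rpow_one]
      _ = ‖f y‖ₑ ^ p := by
          rw [← ENNReal.rpow_add_of_nonneg _ _ zero_le_one hp1.le, add_sub_cancel]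
  rw [lintegral_enorm_rpow_eq_lintegral_measure_lt_norm_mul hu (by linarith), ← hdensity,
    lintegral_enorm_rpow_eq_lintegral_measure_lt_norm_mul (hf.mono_ac hν') hp1]
  calc _ ≤ ENNReal.ofReal p * ∫⁻ t in Set.Ioi (0 : ℝ),
        C * (ν' {y | t < ‖f y‖} * ENNReal.ofReal (t ^ (p - 1 - 1))) := by
        gcongr ENNReal.ofReal p * ?_
        exact setLIntegral_mono' measurableSet_Ioi hweak
    _ = _ := by
        rw [lintegral_const_mul' _ _ ENNReal.coe_ne_top,
          show ENNReal.ofReal p = ENNReal.ofReal (p / (p - 1)) * ENNReal.ofReal (p - 1) by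
            rw [← ENNReal.ofReal_mul' hp1.le, div_mul_cancel₀ _ hp1.ne']]
        ring

theorem eLpNorm_le_of_mul_measure_lt_norm_le {u : α → E} {f : β → F}
    (hu : AEStronglyMeasurable u μ) (hf : AEStronglyMeasurable f ν) {C : ℝ≥0}
    (h : ∀ t : ℝ, 0 < t → ENNReal.ofReal t * μ {x | t < ‖u x‖} ≤
      C * ∫⁻ y in {y | t < ‖f y‖}, ‖f y‖ₑ ∂ν) {p : ℝ≥0} (hp : 1 < p) :
    eLpNorm u p μ ≤ ((C * (p / (p - 1))) ^ (1 / p : ℝ) : ℝ≥0) * eLpNorm f p ν := by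
  have hp0 : p ≠ 0 := (zero_lt_one.trans hp).ne'
  rw [eLpNorm_nnreal_eq_lintegral hp0, eLpNorm_nnreal_eq_lintegral hp0,
    ENNReal.coe_rpow_of_nonneg _ (by positivity), ← ENNReal.mul_rpow_of_nonneg _ _ (by positivity)]
  gcongr
  convert! lintegral_enorm_rpow_le_of_mul_measure_lt_norm_le hu hf h (NNReal.one_lt_coe.2 hp)
  rw [ENNReal.coe_mul, ← NNReal.coe_one, ← NNReal.coe_sub hp.le, ← NNReal.coe_div,
    ENNReal.ofReal_coe_nnreal]

end Analysis

section Rays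

variable {V : Type*} {G : SimpleGraph V} {root : Boundary G}

namespace Ray

/-- The ray obtained by omitting the first `n` vertices. -/
def drop (r : Ray G) (n : ℕ) : Ray G where
  toFun k := r.toFun (n + k)
  adj k := r.adj (n + k)
  inj _ _ h := by simpa using r.inj h

/-- The ray obtained by putting a new vertex in front. -/
def cons (r : Ray G) (x : V) (hx : G.Adj x (r.toFun 0)) (hr : x ∉ Set.range r.toFun) : Ray G where
  toFun n := Nat.casesOn n x r.toFun
  adj n := by cases n with
    | zero => exact hx
    | succ n => exact r.adj n
  inj m n h := by
    cases m <;> cases n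
    · rfl
    · exact absurd ⟨_, h.symm⟩ hr
    · exact absurd ⟨_, h⟩ hr
    · exact congrArg _ (r.inj h)

theorem endpoint_eq_iff {r s : Ray G} :
    r.endpoint = s.endpoint ↔ ∃ m n : ℕ, ∀ k : ℕ, r.toFun (m + k) = s.toFun (n + k) :=
  ⟨fun h => Quotient.exact h, fun h => Quotient.sound h⟩

theorem endpoint_drop (r : Ray G) (n : ℕ) : (r.drop n).endpoint = r.endpoint :=
  endpoint_eq_iff.2 ⟨0, n, fun k => by rw [zero_add]; rfl⟩

section Cons

variable (r : Ray G) (x : V) (hx : G.Adj x (r.toFun 0)) (hr : x ∉ Set.range r.toFun)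

theorem cons_zero : (r.cons x hx hr).toFun 0 = x := rfl

theorem cons_succ (n : ℕ) : (r.cons x hx hr).toFun (n + 1) = r.toFun n := rfl

theorem endpoint_cons : (r.cons x hx hr).endpoint = r.endpoint :=
  endpoint_eq_iff.2 ⟨1, 0, fun k => by rw [add_comm, zero_add]; rfl⟩

end Cons

/-- The initial segment of length `n` of a ray, as a walk. -/
def walk (r : Ray G) : (n : ℕ) → G.Walk (r.toFun 0) (r.toFun n)
  | 0 => .nil
  | n + 1 => (r.walk n).concat (r.adj n)

theorem support_walk (r : Ray G) (n : ℕ) :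
    (r.walk n).support = (List.range (n + 1)).map r.toFun := by
  induction n with
  | zero => rfl
  | succ n ih =>
    rw [walk, SimpleGraph.Walk.support_concat, ih, List.range_succ (n := n + 1), List.map_append,
      List.map_singleton]

theorem isPath_walk (r : Ray G) (n : ℕ) : (r.walk n).IsPath := by
  rw [SimpleGraph.Walk.isPath_def, support_walk]
  exact List.nodup_range.map r.inj

theorem length_walk (r : Ray G) (n : ℕ) : (r.walk n).length = n := by
  simpa [support_walk] using (r.walk n).length_support.symm

theorem dist_eq (hG : G.IsTree) (r : Ray G) (n : ℕ) : G.dist (r.toFun 0) (r.toFun n) = n := by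
  obtain ⟨p, hp, hdist⟩ := hG.connected.exists_path_of_dist (r.toFun 0) (r.toFun n)
  rw [← hdist, (hG.existsUnique_path _ _).unique hp (r.isPath_walk n), length_walk]

theorem eq_of_le_of_toFun_eq (hG : G.IsTree) {r s : Ray G} (h0 : r.toFun 0 = s.toFun 0) {n : ℕ}
    (hn : r.toFun n = s.toFun n) {i : ℕ} (hi : i ≤ n) : r.toFun i = s.toFun i := by
  have hwalk : (r.walk n).copy h0 hn = s.walk n :=
    (hG.existsUnique_path _ _).unique (by simpa using r.isPath_walk n) (s.isPath_walk n)
  have hsupport := congrArg SimpleGraph.Walk.support hwalk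
  simp only [SimpleGraph.Walk.support_copy, support_walk, List.map_inj_left, List.mem_range]
    at hsupport
  exact hsupport i (Nat.lt_succ_of_le hi)

theorem eq_of_endpoint_eq (hG : G.IsTree) {r s : Ray G} (h0 : r.toFun 0 = s.toFun 0)
    (h : r.endpoint = s.endpoint) : r = s := by
  obtain ⟨m, m', hm⟩ := endpoint_eq_iff.1 h
  obtain rfl : m = m' := by
    rw [← r.dist_eq hG m, ← s.dist_eq hG m', h0]
    exact congrArg _ (hm 0)
  have hfun : r.toFun = s.toFun := funext fun n =>
    eq_of_le_of_toFun_eq hG h0 (hm n) (Nat.le_add_left n m)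
  cases r
  cases s
  cases hfun
  rfl

end Ray

theorem exists_ray_of_walk {x y : V} (w : G.Walk x y) (s : Ray G) (hs : s.toFun 0 = y) :
    ∃ r : Ray G, r.toFun 0 = x ∧ r.endpoint = s.endpoint := by
  induction w with
  | nil => exact ⟨s, hs, rfl⟩
  | @cons x y z hxy w ih =>
    obtain ⟨r, rfl, hr⟩ := ih hs
    by_cases hx : x ∈ Set.range r.toFun
    · obtain ⟨n, rfl⟩ := hx
      exact ⟨r.drop n, rfl, by rw [Ray.endpoint_drop, hr]⟩
    · exact ⟨r.cons x hxy hx, rfl, by rw [Ray.endpoint_cons, hr]⟩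

theorem exists_ray (hG : G.IsTree) (root : Boundary G) (x : V) :
    ∃ r : Ray G, r.toFun 0 = x ∧ r.endpoint = root := by
  obtain ⟨s, rfl⟩ := Quotient.exists_rep root
  obtain ⟨w⟩ := hG.connected.preconnected x (s.toFun 0)
  exact exists_ray_of_walk w s rfl

/-- The geodesic from `x` to the boundary point `root`. -/
noncomputable def geodesicRay (hG : G.IsTree) (root : Boundary G) (x : V) : Ray G :=
  (exists_ray hG root x).choose

/-- The next vertex on the geodesic from `x` to `root`. -/
noncomputable def parent (hG : G.IsTree) (root : Boundary G) (x : V) : V :=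
  (geodesicRay hG root x).toFun 1

variable (hG : G.IsTree)

@[simp] theorem geodesicRay_zero (x : V) : (geodesicRay hG root x).toFun 0 = x :=
  (exists_ray hG root x).choose_spec.1

@[simp] theorem endpoint_geodesicRay (x : V) : (geodesicRay hG root x).endpoint = root :=
  (exists_ray hG root x).choose_spec.2

theorem Ray.eq_geodesicRay (r : Ray G) : r = geodesicRay hG r.endpoint (r.toFun 0) :=
  Ray.eq_of_endpoint_eq hG (by simp) (by simp)

theorem Ray.parent_toFun (r : Ray G) (n : ℕ) :
    parent hG r.endpoint (r.toFun n) = r.toFun (n + 1) := by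
  have hdrop := congrArg (fun s => s.toFun 1) ((r.drop n).eq_geodesicRay hG)
  rw [Ray.endpoint_drop] at hdrop
  exact hdrop.symm

theorem Ray.iterate_parent_toFun (r : Ray G) (n k : ℕ) :
    (parent hG r.endpoint)^[k] (r.toFun n) = r.toFun (n + k) := by
  induction k with
  | zero => rfl
  | succ k ih => rw [Function.iterate_succ_apply', ih, r.parent_toFun hG, add_assoc]

theorem geodesicRay_toFun (x : V) (n : ℕ) :
    (geodesicRay hG root x).toFun n = (parent hG root)^[n] x := by
  simpa using ((geodesicRay hG root x).iterate_parent_toFun hG 0 n).symm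

theorem iterate_parent_injective (x : V) :
    Function.Injective fun n => (parent hG root)^[n] x := by
  simpa only [← geodesicRay_toFun] using (geodesicRay hG root x).inj

theorem dist_iterate_parent (x : V) (n : ℕ) : G.dist x ((parent hG root)^[n] x) = n := by
  simpa [geodesicRay_toFun] using (geodesicRay hG root x).dist_eq hG n

theorem adj_parent (x : V) : G.Adj x (parent hG root x) := by
  simpa [parent] using (geodesicRay hG root x).adj 0

theorem parent_eq_or_of_adj (root : Boundary G) {x y : V} (h : G.Adj x y) :
    parent hG root x = y ∨ parent hG root y = x := by
  by_cases hy : y ∈ Set.range (geodesicRay hG root x).toFun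
  · obtain ⟨n, rfl⟩ := hy
    have hn : n = 1 := by
      rw [← SimpleGraph.dist_eq_one_iff_adj.2 h, geodesicRay_toFun, dist_iterate_parent]
    exact .inl (hn ▸ rfl)
  · refine .inr ?_
    have hcons := ((geodesicRay hG root x).cons y (by simpa using h.symm) hy).parent_toFun hG 0
    rwa [Ray.endpoint_cons, endpoint_geodesicRay, Ray.cons_zero, Ray.cons_succ,
      geodesicRay_zero] at hcons

theorem Ray.endpoint_eq_iff_forall_parent {r : Ray G} :
    r.endpoint = root ↔ ∀ n, parent hG root (r.toFun n) = r.toFun (n + 1) := by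
  refine ⟨fun h n => h ▸ r.parent_toFun hG n, fun h => ?_⟩
  rw [← endpoint_geodesicRay hG (root := root) (r.toFun 0), Ray.endpoint_eq_iff]
  refine ⟨0, 0, fun k => ?_⟩
  rw [zero_add, geodesicRay_toFun]
  induction k with
  | zero => rfl
  | succ k ih => rw [← h, ih, Function.iterate_succ_apply']

theorem mem_sector_iff {x y : V} : y ∈ sector root x ↔ ∃ n : ℕ, (parent hG root)^[n] y = x := by
  constructor
  · rintro ⟨r, rfl, rfl, n, rfl⟩
    exact ⟨n, by rw [r.iterate_parent_toFun hG, zero_add]⟩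
  · rintro ⟨n, rfl⟩
    exact ⟨geodesicRay hG root y, by simp, by simp, n, geodesicRay_toFun hG y n⟩

end Rays

section Level

variable {V : Type*} {G : SimpleGraph V} (hG : G.IsTree) (γ : Ray G)

theorem exists_iterate_parent_eq (x : V) :
    ∃ m n : ℕ, (parent hG γ.endpoint)^[m] x = γ.toFun n := by
  obtain ⟨m, n, h⟩ :=
    Ray.endpoint_eq_iff.1 (endpoint_geodesicRay hG (root := γ.endpoint) x)
  exact ⟨m, n, by rw [← geodesicRay_toFun]; exact h 0⟩

theorem level_eq_of_iterate_parent_eq {x : V} {m n : ℕ}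
    (h : (parent hG γ.endpoint)^[m] x = γ.toFun n) : level γ x = (n : ℤ) - m := by
  refine Tendsto.limUnder_eq (tendsto_atTop_of_eventually_const (i₀ := n) fun j hj => ?_)
  obtain ⟨k, rfl⟩ := Nat.exists_eq_add_of_le hj
  rw [← γ.iterate_parent_toFun hG, ← h, ← Function.iterate_add_apply, dist_iterate_parent]
  push_cast
  ring

theorem level_parent (x : V) : level γ (parent hG γ.endpoint x) = level γ x + 1 := by
  obtain ⟨m, n, h⟩ := exists_iterate_parent_eq hG γ x
  have hparent : (parent hG γ.endpoint)^[m] (parent hG γ.endpoint x) = γ.toFun (n + 1) := by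
    rw [← Function.iterate_succ_apply, Function.iterate_succ_apply', h, γ.parent_toFun hG]
  rw [level_eq_of_iterate_parent_eq hG γ h, level_eq_of_iterate_parent_eq hG γ hparent]
  push_cast
  ring

theorem level_iterate_parent (n : ℕ) (x : V) :
    level γ ((parent hG γ.endpoint)^[n] x) = level γ x + n := by
  induction n with
  | zero => simp
  | succ n ih =>
    rw [Function.iterate_succ_apply', level_parent, ih]
    push_cast
    ring

end Level

section Lines

variable {V : Type*} {G : SimpleGraph V} {root : Boundary G} (hG : G.IsTree)

namespace Line

/-- The line `g` with its vertices renumbered, so that the `i`-th one becomes the `0`-th. -/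
def shift (g : Line G) (i : ℤ) : Line G where
  toFun n := g.toFun (i + n)
  adj n := by simpa only [add_assoc] using g.adj (i + n)
  inj _ _ h := by simpa using g.inj h

theorem endpoint_forward_shift (g : Line G) (i : ℤ) :
    (g.shift i).forward.endpoint = g.forward.endpoint := by
  refine Ray.endpoint_eq_iff.2 ⟨(-i).toNat, i.toNat, fun k => congrArg g.toFun ?_⟩
  push_cast
  omega

theorem iterate_parent_toFun (g : Line G) (i : ℤ) (n : ℕ) :
    (parent hG g.forward.endpoint)^[n] (g.toFun i) = g.toFun (i + n) := by
  have hray := (g.shift i).forward.iterate_parent_toFun hG 0 n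
  rw [endpoint_forward_shift, zero_add] at hray
  simpa [forward, shift] using hray

include hG in
theorem exists_toFun_eq_add {g h : Line G} (hfwd : g.forward.endpoint = h.forward.endpoint)
    (hbwd : g.backward.endpoint = h.backward.endpoint) :
    ∃ c, ∀ i, g.toFun i = h.toFun (i + c) := by
  obtain ⟨m, n, hmn⟩ := Ray.endpoint_eq_iff.1 hbwd
  refine ⟨m - n, fun i => ?_⟩
  obtain ⟨k, j, hi⟩ : ∃ k j : ℕ, i = -(m + k : ℕ) + j :=
    ⟨(-i).toNat, (i + (m + (-i).toNat)).toNat, by omega⟩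
  have hk : g.toFun (-(m + k : ℕ)) = h.toFun (-(n + k : ℕ)) := hmn k
  rw [hi, ← g.iterate_parent_toFun hG, hk, hfwd, h.iterate_parent_toFun hG]
  congr 1
  push_cast
  ring

/-- The line through a two-sided sequence of vertices each of which is the parent of the previous
one. -/
def ofParent (f : ℤ → V) (hf : ∀ n, parent hG root (f n) = f (n + 1)) : Line G where
  toFun := f
  adj n := hf n ▸ adj_parent hG (f n)
  inj i j hij := by
    have hiter : ∀ (i : ℤ) (n : ℕ), f (i + n) = (parent hG root)^[n] (f i) := fun i n => by
      induction n with
      | zero => simp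
      | succ n ih => rw [Function.iterate_succ_apply', ← ih, hf, Nat.cast_succ, add_assoc]
    wlog hle : i ≤ j generalizing i j
    · exact (this _ _ hij.symm (le_of_not_ge hle)).symm
    obtain ⟨n, rfl⟩ := Int.le.dest hle
    have hn : n = 0 := iterate_parent_injective hG (f i) ((hiter i n).symm.trans hij.symm)
    rw [hn, Nat.cast_zero, add_zero]

theorem endpoint_forward_ofParent (f : ℤ → V) (hf : ∀ n, parent hG root (f n) = f (n + 1)) :
    (ofParent hG f hf).forward.endpoint = root :=
  (Ray.endpoint_eq_iff_forall_parent hG).2 fun n => hf n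

end Line

include hG

/-- Once a ray steps from a vertex to one of its children it can never turn back, since it would
have to return through the vertex it came from. -/
theorem Ray.exists_forall_parent_toFun_add_one {r : Ray G} (hr : r.endpoint ≠ root) :
    ∃ N, ∀ k, parent hG root (r.toFun (N + k + 1)) = r.toFun (N + k) := by
  obtain ⟨N, hN⟩ : ∃ N, parent hG root (r.toFun (N + 1)) = r.toFun N := by
    by_contra! h
    exact hr ((Ray.endpoint_eq_iff_forall_parent hG).2 fun n =>
      (parent_eq_or_of_adj hG root (r.adj n)).resolve_right (h n))
  refine ⟨N, fun k => ?_⟩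
  induction k with
  | zero => exact hN
  | succ k ih =>
    refine (parent_eq_or_of_adj hG root (r.adj (N + (k + 1)))).resolve_left fun h => ?_
    have hback : N + k = N + (k + 1) + 1 := r.inj (ih.symm.trans h)
    omega

theorem exists_line (ω : PuncturedBoundary G root) :
    ∃ g : Line G, g.backward.endpoint = ω.1 ∧ g.forward.endpoint = root := by
  obtain ⟨⟨s⟩, hs⟩ := ω
  obtain ⟨N, hN⟩ := Ray.exists_forall_parent_toFun_add_one hG (r := s) hs
  let f : ℤ → V := fun n => (parent hG root)^[n.toNat] (s.toFun (N + (-n).toNat))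
  have hf : ∀ n, parent hG root (f n) = f (n + 1) := fun n => by
    rcases lt_or_ge n 0 with hn | hn
    · have hneg : (-n).toNat = (-(n + 1)).toNat + 1 := by omega
      simp only [f, hneg, show n.toNat = 0 by omega, show (n + 1).toNat = 0 by omega,
        Function.iterate_zero, id, ← add_assoc, hN]
    · simp only [f, show (n + 1).toNat = n.toNat + 1 by omega, show (-n).toNat = 0 by omega,
        show (-(n + 1)).toNat = 0 by omega, Function.iterate_succ_apply']
  refine ⟨Line.ofParent hG f hf, Ray.endpoint_eq_iff.2 ⟨0, N, fun k => ?_⟩,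
    Line.endpoint_forward_ofParent hG f hf⟩
  simp [Line.backward, Line.ofParent, f]

end Lines

section SectorBoundary

variable {V : Type*} {G : SimpleGraph V} {root : Boundary G} (hG : G.IsTree)

theorem measurableSet_sectorBoundary (x : V) : MeasurableSet (sectorBoundary root x) :=
  (TopologicalSpace.isOpen_generateFrom_of_mem (Set.mem_range_self x)).measurableSet

include hG

theorem sectorBoundary_subset_of_mem_sector {x y : V} (h : y ∈ sector root x) :
    sectorBoundary root y ⊆ sectorBoundary root x := by
  obtain ⟨n, rfl⟩ := (mem_sector_iff hG).1 h
  rintro ω ⟨g, hbwd, rfl, i, rfl⟩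
  exact ⟨g, hbwd, rfl, i + n, (g.iterate_parent_toFun hG i n).symm⟩

variable {γ : Ray G} {ω : PuncturedBoundary G γ.endpoint} {x y : V}

theorem Line.level_toFun {g : Line G} (hg : g.forward.endpoint = γ.endpoint) (i : ℤ) :
    level γ (g.toFun i) = level γ (g.toFun 0) + i := by
  have hadd : ∀ (i : ℤ) (n : ℕ), level γ (g.toFun (i + n)) = level γ (g.toFun i) + n :=
    fun i n => by rw [← g.iterate_parent_toFun hG, hg, level_iterate_parent hG]
  rcases Int.eq_nat_or_neg i with ⟨n, rfl | rfl⟩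
  · simpa using hadd 0 n
  · have := hadd (-n) n
    rw [neg_add_cancel] at this
    omega

theorem eq_of_mem_sectorBoundary (hx : ω ∈ sectorBoundary γ.endpoint x)
    (hy : ω ∈ sectorBoundary γ.endpoint y) (hl : level γ x = level γ y) : x = y := by
  obtain ⟨g, hg, hg', i, rfl⟩ := hx
  obtain ⟨h, hh, hh', j, rfl⟩ := hy
  obtain ⟨c, hc⟩ := Line.exists_toFun_eq_add hG (hg'.trans hh'.symm) (hg.trans hh.symm)
  rw [hc, Line.level_toFun hG hh', Line.level_toFun hG hh' j, add_right_inj] at hl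
  rw [hc, hl]

theorem pairwise_disjoint_sectorBoundary (k : ℤ) :
    Pairwise (Function.onFun Disjoint
      fun x : {x : V // level γ x = k} => sectorBoundary γ.endpoint x.1) := fun x y hxy =>
  Set.disjoint_left.2 fun _ hx hy =>
    hxy (Subtype.ext (eq_of_mem_sectorBoundary hG hx hy (x.2.trans y.2.symm)))

theorem exists_mem_sectorBoundary (k : ℤ) (ω : PuncturedBoundary G γ.endpoint) :
    ∃ x, level γ x = k ∧ ω ∈ sectorBoundary γ.endpoint x := by
  obtain ⟨g, hg, hg'⟩ := exists_line hG ω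
  refine ⟨g.toFun (k - level γ (g.toFun 0)), ?_, g, hg, hg', _, rfl⟩
  rw [g.level_toFun hG hg', add_sub_cancel]

theorem mem_sector_of_mem_sectorBoundary (hx : ω ∈ sectorBoundary γ.endpoint x)
    (hy : ω ∈ sectorBoundary γ.endpoint y) (hl : level γ y ≤ level γ x) :
    y ∈ sector γ.endpoint x := by
  obtain ⟨n, hn⟩ := Int.le.dest hl
  have hsub := sectorBoundary_subset_of_mem_sector hG (root := γ.endpoint)
    ((mem_sector_iff hG).2 ⟨n, rfl⟩ : y ∈ _)
  refine (mem_sector_iff hG).2 ⟨n, eq_of_mem_sectorBoundary hG (hsub hy) hx ?_⟩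
  rw [level_iterate_parent, hn]

end SectorBoundary

section Countable

variable {V : Type*} {G : SimpleGraph V} (hG : G.IsTree) {γ : Ray G}
  {ν : Measure (PuncturedBoundary G γ.endpoint)}
include hG

theorem countable_setOf_mem_sector_and_level_eq (h0 : ∀ x, flow ν x ≠ 0) {x : V}
    (hx : flow ν x ≠ ∞) (k : ℤ) : {y | y ∈ sector γ.endpoint x ∧ level γ y = k}.Countable := by
  let S := {y | y ∈ sector γ.endpoint x ∧ level γ y = k}
  have hdisj : Pairwise (Function.onFun Disjoint fun y : S => sectorBoundary γ.endpoint y.1) :=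
    fun y z hyz => pairwise_disjoint_sectorBoundary hG k (i := ⟨y, y.2.2⟩) (j := ⟨z, z.2.2⟩)
      (by simpa [Subtype.ext_iff] using hyz)
  have hsub : ⋃ y : S, sectorBoundary γ.endpoint y.1 ⊆ sectorBoundary γ.endpoint x :=
    Set.iUnion_subset fun y => sectorBoundary_subset_of_mem_sector hG y.2.1
  have hpos := Measure.countable_meas_pos_of_disjoint_of_meas_iUnion_ne_top ν
    (fun y : S => measurableSet_sectorBoundary y.1) hdisj
    (ne_top_of_le_ne_top hx (measure_mono hsub))
  have huniv : {y : S | 0 < ν (sectorBoundary γ.endpoint y.1)} = Set.univ :=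
    Set.eq_univ_of_forall fun y => pos_iff_ne_zero.2 (h0 y.1)
  rwa [huniv, Set.countable_univ_iff] at hpos

theorem countable_of_flow_ne_zero_of_ne_top (h0 : ∀ x, flow ν x ≠ 0) (hfin : ∀ x, flow ν x ≠ ∞) :
    Countable V := by
  rw [← Set.countable_univ_iff]
  refine (Set.countable_iUnion fun n : ℕ => Set.countable_iUnion fun k : ℤ =>
    countable_setOf_mem_sector_and_level_eq hG h0 (hfin (γ.toFun n)) k).mono fun x _ => ?_
  obtain ⟨m, n, h⟩ := exists_iterate_parent_eq hG γ x
  exact Set.mem_iUnion₂.2 ⟨n, level γ x, (mem_sector_iff hG).2 ⟨m, h⟩, rfl⟩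

end Countable

section Poisson

variable {V : Type*} {G : SimpleGraph V} {root : Boundary G} {𝕜 : Type*} [RCLike 𝕜]
  {ν : Measure (PuncturedBoundary G root)} {f : PuncturedBoundary G root → 𝕜}

theorem poisson_eq_setAverage (f : PuncturedBoundary G root → 𝕜) (x : V) :
    poisson ν f x = ⨍ ω in sectorBoundary root x, f ω ∂ν := by
  rw [poisson, setAverage_eq, ← integral_smul,
    ← integral_indicator (measurableSet_sectorBoundary x)]
  congr 1 with ω
  by_cases h : ω ∈ sectorBoundary root x <;> simp [poissonKernel, h, flow, Measure.real]

theorem enorm_poisson_mul_rpow_flow_le {p : ℝ≥0∞} (hp : 1 ≤ p) (hf : AEStronglyMeasurable f ν)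
    (x : V) : ‖poisson ν f x‖ₑ * flow ν x ^ (1 / p).toReal ≤
      eLpNorm f p (ν.restrict (sectorBoundary root x)) := by
  simpa [poisson_eq_setAverage, flow] using
    enorm_average_mul_rpow_measure_univ_le_eLpNorm hp (hf.restrict (s := sectorBoundary root x))

theorem enorm_poisson_mul_flow_le (hf : AEStronglyMeasurable f ν) (x : V) :
    ‖poisson ν f x‖ₑ * flow ν x ≤ ∫⁻ ω in sectorBoundary root x, ‖f ω‖ₑ ∂ν := by
  simpa [eLpNorm_one_eq_lintegral_enorm] using enorm_poisson_mul_rpow_flow_le le_rfl hf x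

theorem enorm_poisson_le_eLpNorm_top (hf : AEStronglyMeasurable f ν) (x : V) :
    ‖poisson ν f x‖ₑ ≤ eLpNorm f ∞ ν :=
  calc ‖poisson ν f x‖ₑ ≤ eLpNorm f ∞ (ν.restrict (sectorBoundary root x)) := by
        simpa using enorm_poisson_mul_rpow_flow_le le_top hf x
    _ ≤ eLpNorm f ∞ ν := eLpNorm_restrict_le f ∞ ν _

theorem poisson_indicator_const_of_mem_sector (hG : G.IsTree) {x y : V} (hy : y ∈ sector root x)
    (h0 : flow ν y ≠ 0) (hfin : flow ν y ≠ ∞) (c : 𝕜) :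
    poisson ν ((sectorBoundary root x).indicator fun _ => c) y = c := by
  rw [poisson_eq_setAverage, setAverage_congr_fun (measurableSet_sectorBoundary y)
    (.of_forall fun ω hω =>
      Set.indicator_of_mem (sectorBoundary_subset_of_mem_sector hG hy hω) fun _ => c)]
  exact setAverage_const h0 hfin c

end Poisson

section Carleson

variable {V : Type*} {G : SimpleGraph V} (hG : G.IsTree) {γ : Ray G}
include hG

/-- Vitali covering without enlargement: of two sectors whose boundaries meet, the one of higher
level contains the other. -/
theorem exists_pairwiseDisjoint_sectorBoundary_covering {E : Set V} {N : ℤ}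
    (hE : ∀ x ∈ E, level γ x ≤ N) (hne : ∀ x ∈ E, (sectorBoundary γ.endpoint x).Nonempty) :
    ∃ M ⊆ E, M.PairwiseDisjoint (sectorBoundary γ.endpoint) ∧
      E ⊆ ⋃ x ∈ M, sector γ.endpoint x := by
  obtain ⟨M, hME, hM, hcover⟩ := Vitali.exists_disjoint_subfamily_covering_enlargement
    (sectorBoundary γ.endpoint) E (fun x => (2 : ℝ) ^ level γ x) (3 / 2) (by norm_num)
    (fun x _ => by positivity) (2 ^ N) (fun x hx => zpow_le_zpow_right₀ one_le_two (hE x hx)) hne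
  refine ⟨M, hME, hM, fun x hx => ?_⟩
  obtain ⟨y, hy, ⟨ω, hωx, hωy⟩, hle⟩ := hcover x hx
  have hlt : (2 : ℝ) ^ level γ x < 2 ^ (level γ y + 1) := by
    rw [zpow_add_one₀ two_ne_zero]
    linarith [show (0 : ℝ) < 2 ^ level γ y by positivity]
  have hlevel : level γ x ≤ level γ y :=
    Int.lt_add_one_iff.1 ((zpow_lt_zpow_iff_right₀ one_lt_two).1 hlt)
  exact Set.mem_biUnion hy (mem_sector_of_mem_sectorBoundary hG hωy hωx hlevel)

variable [Countable V] [MeasurableSpace V] {ν : Measure (PuncturedBoundary G γ.endpoint)}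
  {σ : Measure V} (h0 : ∀ x, flow ν x ≠ 0) {C : ℝ≥0}
  (hC : ∀ x : V, σ (sector γ.endpoint x) ≤ C * ν (sectorBoundary γ.endpoint x))
include h0 hC

theorem mul_measure_le_of_mul_flow_le_of_level_le
    {g : PuncturedBoundary G γ.endpoint → ℝ≥0∞} {t : ℝ≥0∞} {E : Set V} {N : ℤ}
    (hN : ∀ x ∈ E, level γ x ≤ N)
    (hE : ∀ x ∈ E, t * flow ν x ≤ ∫⁻ ω in sectorBoundary γ.endpoint x, g ω ∂ν) :
    t * σ E ≤ C * ∫⁻ ω, g ω ∂ν := by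
  obtain ⟨M, hME, hM, hcover⟩ := exists_pairwiseDisjoint_sectorBoundary_covering hG hN
    fun x _ => nonempty_of_measure_ne_zero (h0 x)
  calc t * σ E ≤ t * ∑' y : M, σ (sector γ.endpoint y.1) := by
        gcongr
        exact (measure_mono hcover).trans (measure_biUnion_le σ M.to_countable _)
    _ ≤ t * ∑' y : M, C * flow ν y.1 := by
        gcongr with y
        exact hC y
    _ = C * ∑' y : M, t * flow ν y.1 := by
        rw [ENNReal.tsum_mul_left, ENNReal.tsum_mul_left]
        ring
    _ ≤ C * ∑' y : M, ∫⁻ ω in sectorBoundary γ.endpoint y.1, g ω ∂ν := by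
        gcongr with y
        exact hE _ (hME y.2)
    _ = C * ∫⁻ ω in ⋃ y ∈ M, sectorBoundary γ.endpoint y, g ω ∂ν := by
        rw [lintegral_biUnion M.to_countable (fun y _ => measurableSet_sectorBoundary y) hM]
    _ ≤ C * ∫⁻ ω, g ω ∂ν := by
        gcongr
        exact Measure.restrict_le_self

theorem mul_measure_le_of_mul_flow_le {g : PuncturedBoundary G γ.endpoint → ℝ≥0∞} {t : ℝ≥0∞}
    {E : Set V}
    (hE : ∀ x ∈ E, t * flow ν x ≤ ∫⁻ ω in sectorBoundary γ.endpoint x, g ω ∂ν) :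
    t * σ E ≤ C * ∫⁻ ω, g ω ∂ν := by
  let S : ℕ → Set V := fun N => {x ∈ E | level γ x ≤ N}
  have hS : E = ⋃ N, S N := by
    ext x
    simp only [S, Set.mem_iUnion, Set.mem_sep_iff, exists_and_left, iff_self_and]
    exact fun _ => ⟨(level γ x).toNat, Int.self_le_toNat _⟩
  have hmono : Monotone S := fun M N hMN x hx => ⟨hx.1, hx.2.trans (Int.ofNat_le.2 hMN)⟩
  rw [hS, hmono.directed_le.measure_iUnion, ENNReal.mul_iSup]
  exact iSup_le fun N =>
    mul_measure_le_of_mul_flow_le_of_level_le hG h0 hC (fun x hx => hx.2) fun x hx => hE x hx.1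

variable {𝕜 : Type*} [RCLike 𝕜] {f : PuncturedBoundary G γ.endpoint → 𝕜}

theorem weakL1Norm_poisson_le (hf : AEStronglyMeasurable f ν) :
    weakL1Norm σ (poisson ν f) ≤ C * eLpNorm f 1 ν := by
  rw [eLpNorm_one_eq_lintegral_enorm]
  refine iSup₂_le fun t _ => mul_measure_le_of_mul_flow_le hG h0 hC
    fun x (hx : (t : ℝ) < ‖poisson ν f x‖) => ?_
  have ht : (t : ℝ≥0∞) ≤ ‖poisson ν f x‖ₑ := ENNReal.coe_le_coe.2 hx.le
  exact (mul_le_mul_left ht _).trans (enorm_poisson_mul_flow_le hf x)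

/-- Where `‖2 f‖ ≤ t` the function `f` contributes at most `t / 2` to an average exceeding `t`, so
at least half of that average comes from where `‖2 f‖ > t`. -/
theorem mul_measure_lt_norm_poisson_le (hfin : ∀ x, flow ν x ≠ ∞) (hf : AEStronglyMeasurable f ν)
    {t : ℝ} : ENNReal.ofReal t * σ {x | t < ‖poisson ν f x‖} ≤
      C * ∫⁻ ω in {ω | t < ‖((2 : 𝕜) • f) ω‖}, ‖((2 : 𝕜) • f) ω‖ₑ ∂ν := by
  set A := {ω | t < ‖((2 : 𝕜) • f) ω‖}
  set g := fun ω => ‖((2 : 𝕜) • f) ω‖ₑ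
  refine (mul_measure_le_of_mul_flow_le (g := A.indicator g) hG h0 hC
    fun x (hx : t < ‖poisson ν f x‖) => ?_).trans (mul_le_mul_right (lintegral_indicator_le _ _) _)
  have hsplit : ∀ ω, g ω ≤ A.indicator g ω + ENNReal.ofReal t := fun ω => by
    by_cases hω : ω ∈ A
    · simp [hω]
    · simpa [hω, g, ← ofReal_norm] using ENNReal.ofReal_le_ofReal (not_lt.1 hω)
  have hle : ENNReal.ofReal t * flow ν x + ENNReal.ofReal t * flow ν x ≤
      ∫⁻ ω in sectorBoundary γ.endpoint x, A.indicator g ω ∂ν + ENNReal.ofReal t * flow ν x :=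
    calc _ = 2 * (ENNReal.ofReal t * flow ν x) := (two_mul _).symm
      _ ≤ 2 * (‖poisson ν f x‖ₑ * flow ν x) := by
          rw [← ofReal_norm]
          gcongr
      _ ≤ 2 * ∫⁻ ω in sectorBoundary γ.endpoint x, ‖f ω‖ₑ ∂ν := by
          gcongr
          exact enorm_poisson_mul_flow_le hf x
      _ = ∫⁻ ω in sectorBoundary γ.endpoint x, g ω ∂ν := by
          rw [← lintegral_const_mul' _ _ ENNReal.ofNat_ne_top]
          simp [g, ← ofReal_norm]
      _ ≤ ∫⁻ ω in sectorBoundary γ.endpoint x, (A.indicator g ω + ENNReal.ofReal t) ∂ν :=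
          lintegral_mono hsplit
      _ = _ := by rw [lintegral_add_right _ measurable_const, setLIntegral_const, flow]
  exact (ENNReal.add_le_add_iff_right (ENNReal.mul_ne_top ENNReal.ofReal_ne_top (hfin x))).1 hle

theorem eLpNorm_poisson_le [DiscreteMeasurableSpace V] (hfin : ∀ x, flow ν x ≠ ∞)
    (hf : AEStronglyMeasurable f ν) {p : ℝ≥0} (hp : 1 < p) : eLpNorm (poisson ν f) p σ ≤
      ((C * (p / (p - 1))) ^ (1 / p : ℝ) * 2 : ℝ≥0) * eLpNorm f p ν := by
  have h := eLpNorm_le_of_mul_measure_lt_norm_le (u := poisson ν f) (μ := σ)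
    Measurable.of_discrete.aestronglyMeasurable (hf.const_smul (2 : 𝕜))
    (fun _ _ => mul_measure_lt_norm_poisson_le hG h0 hC hfin hf) hp
  rwa [eLpNorm_const_smul, show ‖(2 : 𝕜)‖ₑ = (2 : ℝ≥0) by simp [← ofReal_norm], ← mul_assoc,
    ← ENNReal.coe_mul] at h

omit hC in
theorem IsCarleson.exists_eLpNorm_poisson_le [DiscreteMeasurableSpace V]
    (hfin : ∀ x, flow ν x ≠ ∞) (h : IsCarleson ν σ) {p : ℝ≥0∞} (hp : 1 < p) :
    ∃ C : ℝ≥0, 0 < C ∧ ∀ f : PuncturedBoundary G γ.endpoint → 𝕜, AEStronglyMeasurable f ν →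
      eLpNorm (poisson ν f) p σ ≤ C * eLpNorm f p ν := by
  obtain ⟨C, hC0, hC⟩ := h
  cases p with
  | top =>
    refine ⟨1, one_pos, fun f hf => ?_⟩
    rw [ENNReal.coe_one, one_mul, eLpNorm_exponent_top]
    exact eLpNormEssSup_le_of_ae_enorm_bound (.of_forall (enorm_poisson_le_eLpNorm_top hf))
  | coe p =>
    have hp1 : 1 < p := ENNReal.one_lt_coe_iff.1 hp
    have hsub : 0 < p - 1 := tsub_pos_of_lt hp1
    exact ⟨_, by positivity, fun f hf => eLpNorm_poisson_le hG h0 hC hfin hf hp1⟩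

end Carleson

section LevelProj

variable {V : Type*} {G : SimpleGraph V} (hG : G.IsTree) {γ : Ray G}

/-- The vertex of level `k` on the doubly infinite geodesic from `ω` to the endpoint of `γ`. For a
function `u` on the tree, `u ∘ levelProj hG k` is the restriction of `u` to the level `k`, seen as
a function on the punctured boundary. -/
noncomputable def levelProj (k : ℤ) (ω : PuncturedBoundary G γ.endpoint) : V :=
  (exists_mem_sectorBoundary hG k ω).choose

theorem levelProj_eq_iff {k : ℤ} {ω : PuncturedBoundary G γ.endpoint} {x : V} :
    levelProj hG k ω = x ↔ level γ x = k ∧ ω ∈ sectorBoundary γ.endpoint x := by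
  obtain ⟨hl, hω⟩ := (exists_mem_sectorBoundary hG k ω).choose_spec
  refine ⟨?_, fun ⟨hx, hxω⟩ => eq_of_mem_sectorBoundary hG hω hxω (hl.trans hx.symm)⟩
  rintro rfl
  exact ⟨hl, hω⟩

theorem levelProj_of_mem_sectorBoundary {ω : PuncturedBoundary G γ.endpoint} {x : V}
    (h : ω ∈ sectorBoundary γ.endpoint x) : levelProj hG (level γ x) ω = x :=
  (levelProj_eq_iff hG).2 ⟨rfl, h⟩

theorem measurable_levelProj [Countable V] [MeasurableSpace V] (k : ℤ) :
    Measurable (levelProj hG (γ := γ) k) := by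
  refine measurable_to_countable' fun x => ?_
  have hpre : levelProj hG k ⁻¹' {x} = {_ω | level γ x = k} ∩ sectorBoundary γ.endpoint x :=
    Set.ext fun _ => levelProj_eq_iff hG
  rw [hpre]
  exact (MeasurableSet.const _).inter (measurableSet_sectorBoundary x)

include hG

theorem iUnion_sectorBoundary (k : ℤ) :
    ⋃ x : {x : V // level γ x = k}, sectorBoundary γ.endpoint x.1 = Set.univ :=
  Set.eq_univ_of_forall fun ω =>
    let ⟨x, hx, hω⟩ := exists_mem_sectorBoundary hG k ω
    Set.mem_iUnion.2 ⟨⟨x, hx⟩, hω⟩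

theorem sectorBoundary_eq_iUnion {k : ℤ} {x : V} (hk : k ≤ level γ x) :
    sectorBoundary γ.endpoint x =
      ⋃ y : {y : V // level γ y = k ∧ y ∈ sector γ.endpoint x}, sectorBoundary γ.endpoint y.1 := by
  refine Set.Subset.antisymm (fun ω hω => ?_)
    (Set.iUnion_subset fun y => sectorBoundary_subset_of_mem_sector hG y.2.2)
  obtain ⟨y, hy, hωy⟩ := exists_mem_sectorBoundary hG k ω
  exact Set.mem_iUnion.2
    ⟨⟨y, hy, mem_sector_of_mem_sectorBoundary hG hω hωy (hy.trans_le hk)⟩, hωy⟩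

variable [Countable V] {ν : Measure (PuncturedBoundary G γ.endpoint)}

theorem tsum_lintegral_sectorBoundary (k : ℤ) (g : PuncturedBoundary G γ.endpoint → ℝ≥0∞) :
    ∑' x : {x : V // level γ x = k}, ∫⁻ ω in sectorBoundary γ.endpoint x.1, g ω ∂ν =
      ∫⁻ ω, g ω ∂ν := by
  rw [← lintegral_iUnion (fun x : {x : V // level γ x = k} => measurableSet_sectorBoundary x.1)
    (pairwise_disjoint_sectorBoundary hG k), iUnion_sectorBoundary hG, setLIntegral_univ]

theorem lintegral_comp_levelProj (k : ℤ) (h : V → ℝ≥0∞) :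
    ∫⁻ ω, h (levelProj hG k ω) ∂ν = ∑' x : {x : V // level γ x = k}, h x * flow ν x := by
  rw [← tsum_lintegral_sectorBoundary hG k]
  refine tsum_congr fun ⟨x, hx⟩ => ?_
  subst hx
  rw [setLIntegral_congr_fun (measurableSet_sectorBoundary x) fun ω hω =>
    congrArg h (levelProj_of_mem_sectorBoundary hG hω), setLIntegral_const, flow]

end LevelProj

section Hardy

variable {V : Type*} {G : SimpleGraph V} (hG : G.IsTree) {γ : Ray G}
  {ν : Measure (PuncturedBoundary G γ.endpoint)} {𝕜 : Type*} [RCLike 𝕜]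
  {f : PuncturedBoundary G γ.endpoint → 𝕜} {p : ℝ≥0∞}

theorem integrableOn_sectorBoundary (hp : 1 ≤ p) (hf : MemLp f p ν) {x : V} (hx : flow ν x ≠ ∞) :
    IntegrableOn f (sectorBoundary γ.endpoint x) ν := by
  have := Fact.mk (lt_top_iff_ne_top.2 hx : ν (sectorBoundary γ.endpoint x) < ∞)
  exact (hf.restrict _).integrable hp

include hG
variable [Countable V]

theorem poisson_comp_levelProj (hfin : ∀ x, flow ν x ≠ ∞) {k : ℤ} {x : V} (hk : k ≤ level γ x)
    (hf : IntegrableOn f (sectorBoundary γ.endpoint x) ν)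
    (hfk : IntegrableOn (fun ω => poisson ν f (levelProj hG k ω)) (sectorBoundary γ.endpoint x) ν) :
    poisson ν (fun ω => poisson ν f (levelProj hG k ω)) x = poisson ν f x := by
  let S := {y : V // level γ y = k ∧ y ∈ sector γ.endpoint x}
  have hdisj : Pairwise (Function.onFun Disjoint fun y : S => sectorBoundary γ.endpoint y.1) :=
    fun y z hyz => pairwise_disjoint_sectorBoundary hG k (i := ⟨y, y.2.1⟩) (j := ⟨z, z.2.1⟩)
      fun h => hyz (Subtype.ext (congrArg (fun w => w.1) h))
  have hmeas := fun y : S => measurableSet_sectorBoundary (root := γ.endpoint) y.1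
  rw [poisson_eq_setAverage, poisson_eq_setAverage f, setAverage_eq, setAverage_eq]
  congr 1
  rw [sectorBoundary_eq_iUnion hG hk] at hf hfk ⊢
  rw [integral_iUnion hmeas hdisj hf, integral_iUnion hmeas hdisj hfk]
  refine tsum_congr fun ⟨y, hy, _⟩ => ?_
  subst hy
  calc ∫ ω in sectorBoundary γ.endpoint y, poisson ν f (levelProj hG (level γ y) ω) ∂ν
      = ∫ _ in sectorBoundary γ.endpoint y, poisson ν f y ∂ν :=
        setIntegral_congr_fun (measurableSet_sectorBoundary y) fun ω hω =>
          congrArg (poisson ν f) (levelProj_of_mem_sectorBoundary hG hω)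
    _ = ∫ ω in sectorBoundary γ.endpoint y, f ω ∂ν := by
        rw [setIntegral_const, poisson_eq_setAverage, measure_smul_setAverage f (hfin y)]

theorem eLpNorm_comp_levelProj_le_hardyNorm (hp : p ≠ 0) (k : ℤ) (u : V → 𝕜) :
    eLpNorm (fun ω => u (levelProj hG k ω)) p ν ≤ hardyNorm γ ν p u := by
  by_cases hpt : p = ∞
  · subst hpt
    rw [hardyNorm, if_pos rfl, eLpNorm_exponent_top]
    exact eLpNormEssSup_le_of_ae_enorm_bound (.of_forall fun ω => le_iSup (fun x => ‖u x‖ₑ) _)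
  · rw [eLpNorm_eq_lintegral_rpow_enorm_toReal hp hpt, hardyNorm, if_neg hpt,
      lintegral_comp_levelProj hG k fun x => ‖u x‖ₑ ^ p.toReal]
    gcongr
    exact le_iSup (fun k : ℤ => ∑' x : {x // level γ x = k}, ‖u x‖ₑ ^ p.toReal * flow ν x) k

theorem hardyNorm_poisson_le (hp : 1 ≤ p) (hf : AEStronglyMeasurable f ν) :
    hardyNorm γ ν p (poisson ν f) ≤ eLpNorm f p ν := by
  by_cases hpt : p = ∞
  · subst hpt
    rw [hardyNorm, if_pos rfl]
    exact iSup_le (enorm_poisson_le_eLpNorm_top hf)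
  have hp0 : p ≠ 0 := (zero_lt_one.trans_le hp).ne'
  have hr : 0 < p.toReal := ENNReal.toReal_pos hp0 hpt
  have hjensen : ∀ x, ‖poisson ν f x‖ₑ ^ p.toReal * flow ν x ≤
      ∫⁻ ω in sectorBoundary γ.endpoint x, ‖f ω‖ₑ ^ p.toReal ∂ν := fun x => by
    have h := enorm_poisson_mul_rpow_flow_le hp hf x
    rw [eLpNorm_eq_lintegral_rpow_enorm_toReal hp0 hpt, one_div, one_div, ENNReal.toReal_inv,
      ENNReal.le_rpow_inv_iff hr, ENNReal.mul_rpow_of_nonneg _ _ hr.le] at h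
    rwa [ENNReal.rpow_inv_rpow hr.ne'] at h
  rw [hardyNorm, if_neg hpt, eLpNorm_eq_lintegral_rpow_enorm_toReal hp0 hpt]
  gcongr
  refine iSup_le fun k => ?_
  rw [← tsum_lintegral_sectorBoundary hG k]
  exact ENNReal.tsum_le_tsum fun x => hjensen x

variable [MeasurableSpace V] [DiscreteMeasurableSpace V] {σ : Measure V} {C : ℝ≥0}

/-- The hypothesis is applied to the averages of `f` over the sectors of level `-N`. Their Poisson
integrals agree with that of `f` from the level `-N` on, so `N → ∞` and Fatou's lemma conclude. -/
theorem eLpNorm_poisson_le_hardyNorm (hfin : ∀ x, flow ν x ≠ ∞) (hp : 1 ≤ p) (hC0 : C ≠ 0)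
    (hC : ∀ f : PuncturedBoundary G γ.endpoint → 𝕜, MemLp f p ν →
      eLpNorm (poisson ν f) p σ ≤ C * eLpNorm f p ν) (hf : MemLp f p ν) :
    eLpNorm (poisson ν f) p σ ≤ C * hardyNorm γ ν p (poisson ν f) := by
  by_cases hH : hardyNorm γ ν p (poisson ν f) = ∞
  · simp [hH, hC0]
  let g : ℕ → PuncturedBoundary G γ.endpoint → 𝕜 := fun N ω =>
    poisson ν f (levelProj hG (-(N : ℤ)) ω)
  have hle : ∀ N, eLpNorm (g N) p ν ≤ hardyNorm γ ν p (poisson ν f) := fun N =>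
    eLpNorm_comp_levelProj_le_hardyNorm hG (zero_lt_one.trans_le hp).ne' _ _
  have hg : ∀ N, MemLp (g N) p ν := fun N =>
    ⟨((Measurable.of_discrete (f := poisson ν f)).comp
      (measurable_levelProj hG _)).aestronglyMeasurable,
      (hle N).trans_lt (lt_top_iff_ne_top.2 hH)⟩
  have heq : ∀ x N, (-level γ x).toNat ≤ N → poisson ν (g N) x = poisson ν f x := fun x N hN =>
    poisson_comp_levelProj hG hfin (by omega) (integrableOn_sectorBoundary hp hf (hfin x))
      (integrableOn_sectorBoundary hp (hg N) (hfin x))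
  exact Lp.eLpNorm_le_of_ae_tendsto (u := atTop) (f := fun N => poisson ν (g N))
    (.of_forall fun N => (hC _ (hg N)).trans (mul_le_mul_right (hle N) _))
    (fun N => Measurable.of_discrete.aestronglyMeasurable)
    (.of_forall fun x => tendsto_atTop_of_eventually_const (heq x))

omit [Countable V] in
theorem isCarleson_of_eLpNorm_poisson_le (𝕜 : Type*) [RCLike 𝕜] (h0 : ∀ x, flow ν x ≠ 0)
    (hfin : ∀ x, flow ν x ≠ ∞) (hp : p ≠ 0) (hpt : p ≠ ∞) (hC0 : 0 < C)
    (hC : ∀ f : PuncturedBoundary G γ.endpoint → 𝕜, MemLp f p ν →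
      eLpNorm (poisson ν f) p σ ≤ C * eLpNorm f p ν) : IsCarleson ν σ := by
  have hr : 0 < p.toReal := ENNReal.toReal_pos hp hpt
  refine ⟨C ^ p.toReal, NNReal.rpow_pos hC0, fun x => ?_⟩
  let χ : PuncturedBoundary G γ.endpoint → 𝕜 := (sectorBoundary γ.endpoint x).indicator fun _ => 1
  have hχ : MemLp χ p ν :=
    memLp_indicator_const p (measurableSet_sectorBoundary x) 1 (.inr (hfin x))
  have hlower : σ (sector γ.endpoint x) ^ (1 / p.toReal) ≤ eLpNorm (poisson ν χ) p σ := by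
    simpa using le_eLpNorm_of_bddBelow hp hpt 1 (.of_discrete (s := sector γ.endpoint x))
      (.of_forall fun y hy => by
        simp [χ, poisson_indicator_const_of_mem_sector hG hy (h0 y) (hfin y)])
  have hupper : eLpNorm χ p ν = ν (sectorBoundary γ.endpoint x) ^ (1 / p.toReal) := by
    simp [χ, eLpNorm_indicator_const (measurableSet_sectorBoundary x) hp hpt]
  have h := hlower.trans (hC χ hχ)
  rwa [hupper, one_div, ENNReal.rpow_inv_le_iff hr, ENNReal.mul_rpow_of_nonneg _ _ hr.le,
    ENNReal.rpow_inv_rpow hr.ne', ← ENNReal.coe_rpow_of_nonneg _ hr.le] at h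

end Hardy

end TreeCarleson

theorem mainTheorem1_general {V : Type*} [MeasurableSpace V] [DiscreteMeasurableSpace V]
    (𝕜 : Type*) [RCLike 𝕜]
    (G : SimpleGraph V) (hG : G.IsTree)
    (root : TreeCarleson.Boundary G)
    (γ : TreeCarleson.Ray G) (hγ : γ.endpoint = root)
    (ν : Measure (TreeCarleson.PuncturedBoundary G root))
    (hν : ∀ x : V, 0 < ν (TreeCarleson.sectorBoundary root x) ∧
      ν (TreeCarleson.sectorBoundary root x) < ∞)
    (σ : Measure V) :
    List.TFAE [
      TreeCarleson.IsCarleson ν σ,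
      (∀ p : ℝ≥0∞, 1 < p → ∃ C : ℝ≥0, 0 < C ∧
        ∀ f : TreeCarleson.PuncturedBoundary G root → 𝕜, MemLp f p ν →
          eLpNorm (TreeCarleson.poisson ν f) p σ ≤ C * eLpNorm f p ν) ∧
      (∃ C : ℝ≥0, 0 < C ∧
        ∀ f : TreeCarleson.PuncturedBoundary G root → 𝕜, MemLp f 1 ν →
          TreeCarleson.weakL1Norm σ (TreeCarleson.poisson ν f) ≤ C * eLpNorm f 1 ν),
      ∀ p : ℝ≥0∞, 1 < p → ∃ C : ℝ≥0, 0 < C ∧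
        ∀ f : TreeCarleson.PuncturedBoundary G root → 𝕜, MemLp f p ν →
          eLpNorm (TreeCarleson.poisson ν f) p σ ≤
            C * TreeCarleson.hardyNorm γ ν p (TreeCarleson.poisson ν f)] := by
  subst hγ
  have h0 : ∀ x, TreeCarleson.flow ν x ≠ 0 := fun x => (hν x).1.ne'
  have hfin : ∀ x, TreeCarleson.flow ν x ≠ ∞ := fun x => (hν x).2.ne
  have := TreeCarleson.countable_of_flow_ne_zero_of_ne_top hG h0 hfin
  tfae_have 1 → 2 := fun h => by
    refine ⟨fun p hp => ?_, ?_⟩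
    · obtain ⟨C, hC0, hC⟩ := h.exists_eLpNorm_poisson_le hG h0 hfin (𝕜 := 𝕜) hp
      exact ⟨C, hC0, fun f hf => hC f hf.aestronglyMeasurable⟩
    · obtain ⟨C, hC0, hC⟩ := h
      exact ⟨C, hC0, fun f hf =>
        TreeCarleson.weakL1Norm_poisson_le hG h0 hC hf.aestronglyMeasurable⟩
  tfae_have 2 → 3 := fun ⟨h, _⟩ p hp => by
    obtain ⟨C, hC0, hC⟩ := h p hp
    exact ⟨C, hC0, fun f =>
      TreeCarleson.eLpNorm_poisson_le_hardyNorm hG hfin hp.le hC0.ne' hC⟩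
  tfae_have 3 → 1 := fun h => by
    obtain ⟨C, hC0, hC⟩ := h 2 ENNReal.one_lt_two
    refine TreeCarleson.isCarleson_of_eLpNorm_poisson_le hG 𝕜 h0 hfin two_ne_zero
      ENNReal.ofNat_ne_top hC0 fun f hf => (hC f hf).trans ?_
    gcongr
    exact TreeCarleson.hardyNorm_poisson_le hG one_le_two hf.aestronglyMeasurable
  tfae_finish

theorem mainTheorem1 {V : Type*} [MeasurableSpace V] [DiscreteMeasurableSpace V]
    (𝕜 : Type*) [RCLike 𝕜]
    (G : SimpleGraph V) [G.LocallyFinite] (hG : G.IsTree)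
    (root : TreeCarleson.Boundary G)
    (γ : TreeCarleson.Ray G) (hγ : γ.endpoint = root)
    (ν : Measure (TreeCarleson.PuncturedBoundary G root))
    (hν : ∀ x : V, 0 < ν (TreeCarleson.sectorBoundary root x) ∧
      ν (TreeCarleson.sectorBoundary root x) < ∞)
    (σ : Measure V) :
    List.TFAE [
      TreeCarleson.IsCarleson ν σ,
      (∀ p : ℝ≥0∞, 1 < p → ∃ C : ℝ≥0, 0 < C ∧
        ∀ f : TreeCarleson.PuncturedBoundary G root → 𝕜, MemLp f p ν →
          eLpNorm (TreeCarleson.poisson ν f) p σ ≤ C * eLpNorm f p ν) ∧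
      (∃ C : ℝ≥0, 0 < C ∧
        ∀ f : TreeCarleson.PuncturedBoundary G root → 𝕜, MemLp f 1 ν →
          TreeCarleson.weakL1Norm σ (TreeCarleson.poisson ν f) ≤ C * eLpNorm f 1 ν),
      ∀ p : ℝ≥0∞, 1 < p → ∃ C : ℝ≥0, 0 < C ∧
        ∀ f : TreeCarleson.PuncturedBoundary G root → 𝕜, MemLp f p ν →
          eLpNorm (TreeCarleson.poisson ν f) p σ ≤
            C * TreeCarleson.hardyNorm γ ν p (TreeCarleson.poisson ν f)] :=
  mainTheorem1_general 𝕜 G hG root γ hγ ν hν σ
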